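/- Let $M$ be a smooth manifold, $N\subset M$ a subset, and $\omega$ a symplectic form on $M$. Let $\mathfrak g$ be a real Lie algebra acting on $M$ through a Lie algebra homomorphism $\xi\mapsto\underline\xi$, $\mathfrak g\to\mathfrak X(M)$. Notation. Put $I_N=\{f\in C^\infty(M): f|_N=0\}$, $\mathfrak X_N(M)=\{u\in\mathfrak X(M): u\,I_N\subset I_N\}$ (fields tangent to $N$) and $I_{\mathfrak X}(N)=\{u\in\mathfrak X(M): u\,C^\infty(M)\subset I_N\}$. Let $I_\Omega(N)$ be the differential ideal of $\Omega(M)$ generated by the forms $\alpha\in\Omega^k(M)$, $k\ge 0$, with $\alpha(u_1,\dots,u_k)\in I_N$ for all $u_1,\dots,u_k\in\mathfrak X_N(M)$, and let $\mathfrak X_{\mathfrak g}(M)$ be the $C^\infty(M)$-submodule of $\mathfrak X(M)$ generated by the fields $\underline\xi$. A form $\alpha$ is reducible if $\mathcal L_{\underline\xi}\alpha\in I_\Omega(N)$ and $\iota_{\underline\xi}\alpha\in I_\Omega(N)$ for all $\xi\in\mathfrak g$. A field $v$ is reducible if $v\in\mathfrak X_N(M)$ and $[v,\underline\xi]\in\mathfrak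 X_{\mathfrak g}(M)+I_{\mathfrak X}(N)$ for all $\xi\in\mathfrak g$. For $f\in C^\infty(M)$ let $v_f$ denote its Hamiltonian vector field, $df=-\iota_{v_f}\omega$. Let $$L_\infty(M,\omega)_{[N]}=\{f\in C^\infty(M): f\text{ and }v_f\text{ are reducible}\},$$ $$I_{L_\infty}(N)=\{f\in L_\infty(M,\omega)_{[N]}: f\in I_\Omega(N),\ v_f\in\mathfrak X_{\mathfrak g}(M)+I_{\mathfrak X}(N)\}.$$ Theorem 4.1. Assume that the action is tangent to $N$, that is, $\underline\xi\in\mathfrak X_N(M)$ for all $\xi\in\mathfrak g$, and that $\omega$ is reducible. Then: 1. every $f\in C^\infty(M)$ has exactly one Hamiltonian vector field $v_f$, and $\{f,h\}=\omega(v_f,v_h)$ makes $C^\infty(M)$ a Poisson algebra $C^\infty(M,\omega)$; 2. $L_\infty(M,\omega)_{[N]}$ is a (unital) Poisson subalgebra of $C^\infty(M,\omega)$; 3. $I_{L_\infty}(N)$ is an ideal of $L_\infty(M,\omega)_{[N]}$ both for the associative product and for the bracket; 4. consequently the reduction $L_\infty(M,\omega)_N=L_\infty(M,\omega)_{[N]}/I_{L_\infty}(N)$,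 with the quotient product, carries exactly one Poisson bracket with $\{[f],[h]\}=[\{f,h\}]$ for all $f,h\in L_\infty(M,\omega)_{[N]}$. -/

import Mathlib

open scoped Manifold ContDiff

set_option linter.unusedSectionVars false

noncomputable section

namespace SymplecticReduction

section Calculus

variable (E : Type*) [NormedAddCommGroup E] [NormedSpace ℝ E] [FiniteDimensional ℝ E]
  (M : Type*) [TopologicalSpace M] [ChartedSpace E M] [IsManifold 𝓘(ℝ, E) ∞ M]

/-- The algebra `C^∞(M)` of smooth real functions on `M`. -/
abbrev SmoothFn := C^∞⟮𝓘(ℝ, E), M; 𝓘(ℝ), ℝ⟯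

/-- The space `𝔛(M)` of smooth vector fields on `M`, that is, smooth sections of `TM`. -/
abbrev VField := Cₛ^∞⟮𝓘(ℝ, E); E, (TangentSpace 𝓘(ℝ, E) : M → Type _)⟯

variable {E M}

/-- `𝔛(M)` is a module over `C^∞(M)` by pointwise multiplication. -/
instance : SMul (SmoothFn E M) (VField E M) :=
  ⟨fun f u => ⟨fun x => f x • u x, ContMDiff.smul_section f.contMDiff u.contMDiff⟩⟩

theorem smul_apply (f : SmoothFn E M) (u : VField E M) (x : M) : (f • u) x = f x • u x := rfl

instance : Module (SmoothFn E M) (VField E M) where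
  one_smul u := by ext x; simp [smul_apply]
  mul_smul f g u := by ext x; simp [smul_apply, mul_smul]
  smul_zero f := by ext x; simp [smul_apply]
  smul_add f u v := by ext x; simp [smul_apply]
  add_smul f g u := by ext x; simp [smul_apply, add_smul]
  zero_smul u := by ext x; simp [smul_apply]

/-- The derivative `u f ∈ C^∞(M)` of a smooth function `f` along a vector field `u`. -/
def dir (u : VField E M) (f : SmoothFn E M) : SmoothFn E M :=
  ⟨fun x => (mfderiv 𝓘(ℝ, E) 𝓘(ℝ) f x (u x) : ℝ),
    (contMDiff_snd_tangentBundle_modelSpace ℝ 𝓘(ℝ)).comp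
      ((f.contMDiff.contMDiff_tangentMap (m := ∞) (by simp)).comp u.contMDiff)⟩

theorem contMDiff_mlieBracket (u v : VField E M) :
    ContMDiff 𝓘(ℝ, E) (𝓘(ℝ, E).prod 𝓘(ℝ, E)) ∞
      (fun x => (⟨x, VectorField.mlieBracket 𝓘(ℝ, E) u v x⟩ : TangentBundle 𝓘(ℝ, E) M)) := by
  have := FiniteDimensional.complete ℝ E
  have : IsManifold 𝓘(ℝ, E) ((⊤ : ℕ∞) + 1) M := by
    simpa using (inferInstance : IsManifold 𝓘(ℝ, E) ∞ M)
  have : IsManifold 𝓘(ℝ, E) (minSmoothness ℝ 2) M :=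
    IsManifold.of_le (n := ∞) (by
      simpa using WithTop.coe_le_coe.2 (le_top : (2 : ℕ∞) ≤ ⊤))
  intro x
  exact ContMDiffAt.mlieBracket_vectorField (n := ⊤) (m := ⊤) (u.contMDiff x) (v.contMDiff x)
    (by simp)

/-- The Lie bracket `[u, v]` of vector fields, with `[u, v] f = u (v f) - v (u f)`. -/
def lieBracket (u v : VField E M) : VField E M :=
  ⟨fun x => VectorField.mlieBracket 𝓘(ℝ, E) u v x, contMDiff_mlieBracket u v⟩

variable (E M) in
/-- The space `Ω^k(M)` of smooth differential `k`-forms: an alternating `k`-linear form on each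
tangent space, with smooth values on smooth vector fields. -/
@[ext]
structure Form (k : ℕ) where
  toFun (x : M) : TangentSpace 𝓘(ℝ, E) x [⋀^Fin k]→ₗ[ℝ] ℝ
  smooth (u : Fin k → VField E M) :
    ContMDiff 𝓘(ℝ, E) 𝓘(ℝ) ∞ fun x => toFun x fun i => u i x

namespace Form

variable {k l : ℕ}

instance : CoeFun (Form E M k) fun _ => (x : M) → TangentSpace 𝓘(ℝ, E) x [⋀^Fin k]→ₗ[ℝ] ℝ :=
  ⟨toFun⟩

/-- The smooth function `α(u₁, …, u_k)`. -/
def eval (α : Form E M k) (u : Fin k → VField E M) : SmoothFn E M :=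
  ⟨fun x => α x fun i => u i x, α.smooth u⟩

instance : Zero (Form E M k) := ⟨⟨fun _ => 0, fun _ => contMDiff_const⟩⟩

instance : Add (Form E M k) :=
  ⟨fun α β => ⟨fun x => α x + β x, fun u => (α.smooth u).add (β.smooth u)⟩⟩

instance : Neg (Form E M k) := ⟨fun α => ⟨fun x => -α x, fun u => (α.smooth u).neg⟩⟩

/-- A smooth function regarded as a `0`-form. -/
def ofFn (f : SmoothFn E M) : Form E M 0 :=
  ⟨fun x => AlternatingMap.constOfIsEmpty ℝ (TangentSpace 𝓘(ℝ, E) x) (Fin 0) (f x),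
    fun _ => f.contMDiff⟩

/-- The contraction `ι_v α = α(v, ·, …, ·)`, which is zero on `0`-forms. -/
def interior (v : VField E M) : {k : ℕ} → Form E M k → Form E M (k - 1)
  | 0, _ => 0
  | _ + 1, α => ⟨fun x => (α x).curryLeft (v x), fun u => by
      convert! α.smooth (Fin.cons v u) using 2 with x
      refine congrArg (α x) (funext fun i => ?_)
      refine Fin.cases ?_ (fun j => ?_) i <;> simp⟩

/-- The wedge product `α ∧ β`, with
`(α ∧ β)(w) = (k! l!)⁻¹ ∑_σ sign(σ) α(w_{σ(1)}, …, w_{σ(k)}) β(w_{σ(k+1)}, …, w_{σ(k+l)})`. -/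
def wedge (α : Form E M k) (β : Form E M l) : Form E M (k + l) where
  toFun x := ((k.factorial * l.factorial : ℝ)⁻¹) • MultilinearMap.alternatization
    (((LinearMap.mul' ℝ ℝ).compMultilinearMap
      ((α x).toMultilinearMap.domCoprod (β x).toMultilinearMap)).domDomCongr finSumFinEquiv)
  smooth u := by
    have h (σ : Equiv.Perm (Fin (k + l))) := contMDiff_const (c := ((σ.sign : ℤ) : ℝ)) |>.mul
      ((α.smooth fun i => u (σ (Fin.castAdd l i))).mul (β.smooth fun i => u (σ (Fin.natAdd k i))))
    convert! contMDiff_const (c := (k.factorial * l.factorial : ℝ)⁻¹) |>.mul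
      (contMDiff_finsetSum (t := Finset.univ) fun σ _ => h σ) using 2 with x
    simp only [MultilinearMap.alternatization_apply, AlternatingMap.smul_apply, smul_eq_mul]
    refine congrArg _ (Finset.sum_congr rfl fun σ _ => ?_)
    simp [Units.smul_def]

/-- `β = d α`, through the invariant formula
`dα(u₀, …, u_k) = ∑_i (-1)^i u_i (α(u₀, …, û_i, …, u_k))
  + ∑_{i < j} (-1)^{i + j} α([u_i, u_j], u₀, …, û_i, …, û_j, …, u_k)`.
In the second sum the entry `[u_i, u_j]` is moved to the place of `u_j` in the list
`u₀, …, û_i, …, u_k`, which takes `j - 1` transpositions and turns the sign into `(-1)^{i + 1}`. -/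
def IsExtDeriv (α : Form E M k) (β : Form E M (k + 1)) : Prop :=
  ∀ u : Fin (k + 1) → VField E M,
    β.eval u =
      ∑ i : Fin (k + 1), (-1 : ℝ) ^ (i : ℕ) • dir (u i) (α.eval (i.removeNth u)) +
      ∑ i : Fin (k + 1), ∑ j ∈ Finset.Ioi i, (-1 : ℝ) ^ ((i : ℕ) + 1) •
        α.eval (i.removeNth (Function.update u j (lieBracket (u i) (u j))))

/-- `β = L_v α`, through
`(L_v α)(u₁, …, u_k) = v (α(u₁, …, u_k)) - ∑_i α(u₁, …, [v, u_i], …, u_k)`. -/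
def IsLieDeriv (v : VField E M) (α β : Form E M k) : Prop :=
  ∀ u : Fin k → VField E M,
    β.eval u = dir v (α.eval u) -
      ∑ i : Fin k, α.eval (Function.update u i (lieBracket v (u i)))

/-- A symplectic form: a closed nondegenerate `2`-form. -/
structure IsSymplectic (Ω : Form E M 2) : Prop where
  closed : Ω.IsExtDeriv 0
  nondegenerate (x : M) (v : TangentSpace 𝓘(ℝ, E) x) : (∀ w, Ω x ![v, w] = 0) → v = 0

end Form

end Calculus

section Reduction

variable {E : Type*} [NormedAddCommGroup E] [NormedSpace ℝ E] [FiniteDimensional ℝ E]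
  {M : Type*} [TopologicalSpace M] [ChartedSpace E M] [IsManifold 𝓘(ℝ, E) ∞ M]

/-- `I_N`: the smooth functions vanishing on `N`. -/
def constraintIdeal (N : Set M) : Set (SmoothFn E M) := {f | ∀ x ∈ N, f x = 0}

/-- `𝔛_N(M)`: the vector fields tangent to `N`, that is, `u I_N ⊆ I_N`. -/
def tangentFields (N : Set M) : Set (VField E M) :=
  {u | ∀ f ∈ constraintIdeal N, dir u f ∈ constraintIdeal N}

/-- `I_𝔛(N)`: the vector fields vanishing along `N`, that is, `u C^∞(M) ⊆ I_N`. -/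
def vanishingFields (N : Set M) : Set (VField E M) :=
  {u | ∀ f, dir u f ∈ constraintIdeal N}

/-- The homogeneous elements of the vanishing de Rham ideal `I_Ω(N)`: the differential ideal of
`Ω(M)` generated by the forms `α` with `α(u₁, …, u_k) ∈ I_N` for all vector fields `u_i` tangent
to `N`. As the generators are homogeneous, so is the ideal. -/
inductive VanishesAlong (N : Set M) : {k : ℕ} → Form E M k → Prop
  | generator {k : ℕ} (α : Form E M k)
      (h : ∀ u : Fin k → VField E M, (∀ i, u i ∈ tangentFields N) →
        α.eval u ∈ constraintIdeal N) : VanishesAlong N α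
  | add {k : ℕ} (α β : Form E M k) :
      VanishesAlong N α → VanishesAlong N β → VanishesAlong N (α + β)
  | wedge_left {k l : ℕ} (β : Form E M k) (α : Form E M l) :
      VanishesAlong N α → VanishesAlong N (β.wedge α)
  | wedge_right {k l : ℕ} (α : Form E M k) (β : Form E M l) :
      VanishesAlong N α → VanishesAlong N (α.wedge β)
  | extDeriv {k : ℕ} (α : Form E M k) (β : Form E M (k + 1)) :
      α.IsExtDeriv β → VanishesAlong N α → VanishesAlong N β

variable (E M) in
/-- An action of the Lie algebra `𝔤` on `M`: a Lie algebra homomorphism `ξ ↦ ξ_M` from `𝔤` to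
`𝔛(M)`. -/
structure LieAction (𝔤 : Type*) [LieRing 𝔤] [LieAlgebra ℝ 𝔤] where
  toLinearMap : 𝔤 →ₗ[ℝ] VField E M
  map_lie (ξ η : 𝔤) : toLinearMap ⁅ξ, η⁆ = lieBracket (toLinearMap ξ) (toLinearMap η)

variable {𝔤 : Type*} [LieRing 𝔤] [LieAlgebra ℝ 𝔤]

instance : CoeFun (LieAction E M 𝔤) fun _ => 𝔤 → VField E M := ⟨fun ρ => ρ.toLinearMap⟩

/-- The action is tangent to `N`. -/
def LieAction.IsTangent (ρ : LieAction E M 𝔤) (N : Set M) : Prop := ∀ ξ, ρ ξ ∈ tangentFields N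

/-- `𝔛_𝔤(M)`: the `C^∞(M)`-submodule of `𝔛(M)` generated by the fundamental vector fields. -/
def LieAction.fundamentalModule (ρ : LieAction E M 𝔤) : Submodule (SmoothFn E M) (VField E M) :=
  Submodule.span (SmoothFn E M) (Set.range ρ)

/-- `𝔛_𝔤(M) + I_𝔛(N)`. -/
def LieAction.fundamentalAlong (ρ : LieAction E M 𝔤) (N : Set M) : Set (VField E M) :=
  {u | ∃ v ∈ ρ.fundamentalModule, ∃ w ∈ vanishingFields N, u = v + w}

/-- Reducible forms: `L_ξ α ∈ I_Ω(N)` and `ι_ξ α ∈ I_Ω(N)` for all `ξ ∈ 𝔤`. -/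
def Form.IsReducible (ρ : LieAction E M 𝔤) (N : Set M) {k : ℕ} (α : Form E M k) : Prop :=
  ∀ ξ : 𝔤, (∃ β : Form E M k, Form.IsLieDeriv (ρ ξ) α β ∧ VanishesAlong N β) ∧
    VanishesAlong N (Form.interior (ρ ξ) α)

/-- `𝔛(M)_[N]`: the reducible vector fields. -/
def reducibleFields (ρ : LieAction E M 𝔤) (N : Set M) : Set (VField E M) :=
  {v | v ∈ tangentFields N ∧ ∀ ξ : 𝔤, lieBracket v (ρ ξ) ∈ ρ.fundamentalAlong N}

/-- The pairs `(v, f)` with `df = -ι_v ω`, that is, `v` is a Hamiltonian vector field of `f`. For a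
`1`-plectic `ω` these make up the whole graded space `Ham_∞(M, ω)`, which sits in degree `0`. -/
def hamPairs (Ω : Form E M 2) : Set (VField E M × SmoothFn E M) :=
  {p | (Form.ofFn p.2).IsExtDeriv (-Form.interior p.1 Ω)}

/-- `Ham_∞(M, ω)_[N]`: the reducible observables. -/
def reducibleObservables (Ω : Form E M 2) (ρ : LieAction E M 𝔤) (N : Set M) :
    Set (VField E M × SmoothFn E M) :=
  {p ∈ hamPairs Ω | p.1 ∈ reducibleFields ρ N ∧ (Form.ofFn p.2).IsReducible ρ N}

/-- The vanishing observable ideal of `Ham_∞(M, ω)_[N]`. -/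
def vanishingObservables (Ω : Form E M 2) (ρ : LieAction E M 𝔤) (N : Set M) :
    Submodule ℝ (VField E M × SmoothFn E M) :=
  Submodule.span ℝ {p ∈ reducibleObservables Ω ρ N |
    p.1 ∈ ρ.fundamentalAlong N ∧ VanishesAlong N (Form.ofFn p.2)}

/-- `L_∞(M, ω)_[N]`: the image of `Ham_∞(M, ω)_[N]` under `(v, f) ↦ f`. -/
def LInftyReducible (Ω : Form E M 2) (ρ : LieAction E M 𝔤) (N : Set M) : Set (SmoothFn E M) :=
  Prod.snd '' reducibleObservables Ω ρ N

/-- `I_{L_∞}(N)`: the image of the vanishing observable ideal under `(v, f) ↦ f`. -/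
def LInftyVanishing (Ω : Form E M 2) (ρ : LieAction E M 𝔤) (N : Set M) : Set (SmoothFn E M) :=
  Prod.snd '' (vanishingObservables Ω ρ N : Set (VField E M × SmoothFn E M))

end Reduction

/-- A Poisson structure on a commutative real algebra: a Lie bracket that is a derivation in its
second (hence in each) argument. -/
structure PoissonStructure (A : Type*) [CommRing A] [Algebra ℝ A] where
  bracket : A →ₗ[ℝ] A →ₗ[ℝ] A
  self (a : A) : bracket a a = 0
  jacobi (a b c : A) :
    bracket a (bracket b c) + bracket b (bracket c a) + bracket c (bracket a b) = 0
  leibniz (a b c : A) : bracket a (b * c) = bracket a b * c + b * bracket a c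

end SymplecticReduction

end

/-! A function `f` is handled together with its Hamiltonian field, as a pair `(v, f)` with `Ω(v, ·)
= -df`. Nondegeneracy gives `v` uniquely at each point, and Cramer's rule in a local frame shows
that it is smooth. Since `Ω(v_f, v_h) = v_f h`, the bracket can be taken to be `v_f h`. Closedness
of `Ω` says that `[v_f, v_h]` is the Hamiltonian field of `v_f h` (`hamPairs_lieBracket`), and the
Jacobi identity becomes the commutator formula `dir_lieBracket`.

For the reduction, the ideal `I_Ω(N)` is harmless in degree `0`. All its elements take values in
`I_N` on tangent fields (`VanishesAlong.eval_mem`), so a function lies in it exactly when it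
vanishes on `N`, and `f` is reducible exactly when every `ξ_M f` lies in `I_N`. Moreover `𝔛_𝔤(M) +
I_𝔛(N)` is a `C^∞(M)`-module, stable under bracket with reducible fields
(`lieBracket_mem_alongModule`). The closure properties follow from the operations `(f • w + h • v, f
* h)` and `([v, w], v h)` on pairs, by the Leibniz and Jacobi rules. The last statement is the
general fact that a Poisson algebra modulo a Poisson ideal is a Poisson algebra. -/

noncomputable section

namespace SymplecticReduction

/-! ### Vector fields as derivations of `C^∞(M)`; local frames and test functions. -/

section Calculus

variable {E : Type*} [NormedAddCommGroup E] [NormedSpace ℝ E] [FiniteDimensional ℝ E]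
  {M : Type*} [TopologicalSpace M] [ChartedSpace E M] [IsManifold 𝓘(ℝ, E) ∞ M]

theorem dir_apply (u : VField E M) (f : SmoothFn E M) (x : M) :
    dir u f x = mfderiv 𝓘(ℝ, E) 𝓘(ℝ) f x (u x) := rfl

theorem SmoothFn.mdifferentiableAt (f : SmoothFn E M) (x : M) :
    MDifferentiableAt 𝓘(ℝ, E) 𝓘(ℝ) f x :=
  f.contMDiff.mdifferentiableAt (by simp)

/-- The derivation `f ↦ u f` of `C^∞(M)` defined by a vector field `u`. -/
def dirDerivation (u : VField E M) : Derivation ℝ (SmoothFn E M) (SmoothFn E M) where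
  toFun := dir u
  map_add' f g := by
    ext x
    change mfderiv 𝓘(ℝ, E) 𝓘(ℝ) (⇑f + ⇑g) x (u x) = _
    rw [mfderiv_add (f.mdifferentiableAt x) (g.mdifferentiableAt x)]
    rfl
  map_smul' c f := by
    ext x
    change mfderiv 𝓘(ℝ, E) 𝓘(ℝ) (c • ⇑f) x (u x) = _
    rw [const_smul_mfderiv (f.mdifferentiableAt x)]
    rfl
  map_one_eq_zero' := by
    ext x
    change mfderiv 𝓘(ℝ, E) 𝓘(ℝ) (fun _ : M => (1 : ℝ)) x (u x) = _
    rw [mfderiv_const]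
    rfl
  leibniz' f g := by
    ext x
    change mfderiv 𝓘(ℝ, E) 𝓘(ℝ) (⇑f * ⇑g) x (u x) = _
    rw [((f.mdifferentiableAt x).hasMFDerivAt.mul (g.mdifferentiableAt x).hasMFDerivAt).mfderiv]
    rfl

/-- The chain rule: the differential of the inverse chart cancels the inverse contained in the
pulled-back field. It moves `dir` to the model space on the whole chart target. -/
theorem fderiv_comp_extChartAt_symm (u : VField E M) (f : SmoothFn E M) (x : M) {y : E}
    (hy : y ∈ (extChartAt 𝓘(ℝ, E) x).target) :
    fderiv ℝ (f ∘ (extChartAt 𝓘(ℝ, E) x).symm) y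
      (VectorField.mpullbackWithin 𝓘(ℝ, E) 𝓘(ℝ, E) (extChartAt 𝓘(ℝ, E) x).symm u
        (Set.range 𝓘(ℝ, E)) y) = dir u f ((extChartAt 𝓘(ℝ, E) x).symm y) := by
  have hφ := mdifferentiableWithinAt_extChartAt_symm (I := 𝓘(ℝ, E)) hy
  have hinv := isInvertible_mfderivWithin_extChartAt_symm (I := 𝓘(ℝ, E)) hy
  rw [VectorField.mpullbackWithin_apply, dir_apply]
  simp only [modelWithCornersSelf_coe, Set.range_id, mfderivWithin_univ,
    mdifferentiableWithinAt_univ] at hφ hinv ⊢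
  rw [← mfderiv_eq_fderiv, mfderiv_comp y (f.mdifferentiableAt _) hφ]
  obtain ⟨A, hA⟩ := hinv
  rw [← hA, ContinuousLinearMap.inverse_equiv]
  change mfderiv 𝓘(ℝ, E) 𝓘(ℝ) f _ (A (A.symm _)) = _
  rw [A.apply_symm_apply]

/-- In the chart at `x` this is the formula for vector fields on `E`, where the second derivative of
`F` drops out by symmetry. -/
theorem dir_lieBracket (u v : VField E M) (f : SmoothFn E M) :
    dir (lieBracket u v) f = dir u (dir v f) - dir v (dir u f) := by
  have := FiniteDimensional.complete ℝ E
  ext x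
  set φ := extChartAt 𝓘(ℝ, E) x with hφ
  set F : E → ℝ := f ∘ φ.symm with hF
  set U := VectorField.mpullbackWithin 𝓘(ℝ, E) 𝓘(ℝ, E) φ.symm u (Set.range 𝓘(ℝ, E)) with hU
  set V := VectorField.mpullbackWithin 𝓘(ℝ, E) 𝓘(ℝ, E) φ.symm v (Set.range 𝓘(ℝ, E)) with hV
  -- The tangent space at `x` is identified with `E` through the chart at `x`, whose derivative at
  -- `x` is therefore the identity.
  have hbr : (lieBracket u v x : E) = VectorField.lieBracket ℝ U V (φ x) := by
    change VectorField.mlieBracketWithin 𝓘(ℝ, E) u v Set.univ x = _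
    rw [VectorField.mlieBracketWithin_apply, mfderiv_extChartAt_self]
    change (ContinuousLinearMap.id ℝ E).inverse _ = _
    have hs : φ.symm ⁻¹' Set.univ ∩ Set.range 𝓘(ℝ, E) = Set.univ := by simp
    rw [ContinuousLinearMap.inverse_id]
    change VectorField.lieBracketWithin ℝ U V (φ.symm ⁻¹' Set.univ ∩ Set.range 𝓘(ℝ, E)) (φ x) = _
    rw [hs]
    exact congrFun VectorField.lieBracketWithin_univ _
  have hnhds : φ.target ∈ nhds (φ x) := extChartAt_target_mem_nhds x
  have hcd : ContDiffAt ℝ ∞ F (φ x) := by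
    have h := (contMDiffAt_iff.1 (f.contMDiff x)).2
    rwa [modelWithCornersSelf_coe, Set.range_id, contDiffWithinAt_univ] at h
  have hdiff (w : VField E M) : DifferentiableAt ℝ (VectorField.mpullbackWithin 𝓘(ℝ, E) 𝓘(ℝ, E)
      φ.symm w (Set.range 𝓘(ℝ, E))) (φ x) := by
    have h := VectorField.contMDiffWithinAt_mpullbackWithin_extChartAt_symm (m := 1) (n := ∞)
      (s := Set.univ) ((w.contMDiff x).of_le (by simp)).contMDiffWithinAt uniqueMDiffOn_univ
      (Set.mem_univ x) (by
        simpa [one_add_one_eq_two] using WithTop.coe_le_coe.2 (le_top : (2 : ℕ∞) ≤ ⊤))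
    rw [Set.preimage_univ, Set.inter_univ] at h
    exact ((contMDiffWithinAt_vectorSpace_iff_contDiffWithinAt.1 h).contDiffAt
      hnhds).differentiableAt one_ne_zero
  have hx : φ.symm (φ x) = x := extChartAt_to_inv x
  have key (w w' : VField E M) : dir w (dir w' f) x =
      fderiv ℝ (fun y => fderiv ℝ F y (VectorField.mpullbackWithin 𝓘(ℝ, E) 𝓘(ℝ, E) φ.symm w'
        (Set.range 𝓘(ℝ, E)) y)) (φ x)
        (VectorField.mpullbackWithin 𝓘(ℝ, E) 𝓘(ℝ, E) φ.symm w (Set.range 𝓘(ℝ, E)) (φ x)) := by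
    have h1 := fderiv_comp_extChartAt_symm w (dir w' f) x (mem_extChartAt_target x)
    rw [← hφ, hx] at h1
    rw [← h1]
    congr 1
    -- The inner function is differentiated again, so the chart formula is needed on a neighbourhood
    -- of `φ x`.
    refine Filter.EventuallyEq.fderiv_eq ?_
    filter_upwards [hnhds] with y hy
    exact (fderiv_comp_extChartAt_symm w' f x hy).symm
  have h0 : dir (lieBracket u v) f x = fderiv ℝ F (φ x) (lieBracket u v x) := by
    rw [dir_apply, (f.mdifferentiableAt x).mfderiv, modelWithCornersSelf_coe, Set.range_id,
      fderivWithin_univ]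
    rfl
  rw [h0]
  erw [hbr, VectorField.fderiv_apply_lieBracket hcd (by
    simpa using WithTop.coe_le_coe.2 (le_top : (2 : ℕ∞) ≤ ⊤)) (hdiff v) (hdiff u)]
  simp only [ContMDiffMap.coe_sub, Pi.sub_apply, key]

variable [T2Space M]

/-- Near every point, some global vector fields form a frame of the tangent bundle. -/
theorem exists_vField_frame (x₀ : M) :
    ∃ e : Fin (Module.finrank ℝ E) → VField E M, ∀ᶠ x in nhds x₀,
      ∃ B : Module.Basis (Fin (Module.finrank ℝ E)) ℝ (TangentSpace 𝓘(ℝ, E) x),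
        ∀ i, e i x = B i := by
  set t := trivializationAt E (TangentSpace 𝓘(ℝ, E)) x₀
  have ht : t.baseSet = (chartAt E x₀).source := TangentBundle.trivializationAt_baseSet x₀
  set b := Module.finBasis ℝ E
  obtain ⟨ψ⟩ : Nonempty (SmoothBumpFunction 𝓘(ℝ, E) x₀) := inferInstance
  -- The cutoff `ψ` is supported in the chart domain, which makes these fields smooth on all of `M`.
  -- Where `ψ = 1` they are the local frame itself.
  refine ⟨fun i => ⟨(⇑ψ) • t.localFrame b i, ?_⟩, ?_⟩
  · refine ContMDiffOn.smul_section_of_tsupport (ψ.contMDiff.contMDiffOn)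
      (chartAt E x₀).open_source ψ.tsupport_subset_chartAt_source ?_
    rw [← ht]
    exact t.contMDiffOn_localFrame_baseSet _ b i
  · filter_upwards [ψ.eventuallyEq_one, (chartAt E x₀).open_source.mem_nhds
      (mem_chart_source E x₀)] with x hx hxs
    refine ⟨t.basisAt b (ht ▸ hxs), fun i => ?_⟩
    rw [← t.localFrame_apply_of_mem_baseSet]
    change ψ x • t.localFrame b i x = _
    rw [hx, Pi.one_apply, one_smul]

/-- A tangent vector annihilating all smooth functions is zero. -/
theorem tangent_eq_zero_of_mfderiv (x : M) (v : TangentSpace 𝓘(ℝ, E) x)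
    (h : ∀ f : SmoothFn E M, mfderiv 𝓘(ℝ, E) 𝓘(ℝ) f x v = (0 : ℝ)) : v = 0 := by
  obtain ⟨ψ⟩ : Nonempty (SmoothBumpFunction 𝓘(ℝ, E) x) := inferInstance
  refine (SeparatingDual.eq_zero_iff_forall_dual_eq_zero (R := ℝ) (V := E) v).2 fun l => ?_
  have hφ := mdifferentiableAt_extChartAt (I := 𝓘(ℝ, E)) (mem_chart_source E x)
  -- The test function is the functional `l` in the chart, cut off by `ψ`; its derivative at `x` is
  -- `l`.
  have hsmooth : ContMDiff 𝓘(ℝ, E) 𝓘(ℝ) ∞ fun y => ψ y • l (extChartAt 𝓘(ℝ, E) x y) :=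
    ψ.contMDiff_smul (l.contMDiff.comp_contMDiffOn contMDiffOn_extChartAt)
  rw [← h ⟨_, hsmooth⟩]
  have heq : (fun y => ψ y • l (extChartAt 𝓘(ℝ, E) x y)) =ᶠ[nhds x]
      l ∘ extChartAt 𝓘(ℝ, E) x := by
    filter_upwards [ψ.eventuallyEq_one] with y hy
    rw [hy, Pi.one_apply, one_smul, Function.comp_apply]
  change _ = mfderiv 𝓘(ℝ, E) 𝓘(ℝ) (fun y => ψ y • l (extChartAt 𝓘(ℝ, E) x y)) x v
  rw [heq.mfderiv_eq, mfderiv_comp x (I' := 𝓘(ℝ, E)) l.mdifferentiableAt hφ,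
    mfderiv_extChartAt_self, ContinuousLinearMap.mfderiv_eq]
  rfl

/-- Reduces identities between vector fields to identities between operators on functions; all the
bracket rules below are proved this way. -/
theorem dir_injective : Function.Injective (dir : VField E M → SmoothFn E M → SmoothFn E M) := by
  intro u v h
  ext x
  refine sub_eq_zero.1 (tangent_eq_zero_of_mfderiv x _ fun f => ?_)
  rw [map_sub]
  exact sub_eq_zero.2 (congrArg (· x) (congrFun h f))

end Calculus

/-! ### Existence and uniqueness of Hamiltonian vector fields. -/

section Hamiltonian

variable {E : Type*} [NormedAddCommGroup E] [NormedSpace ℝ E] [FiniteDimensional ℝ E]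
  {M : Type*} [TopologicalSpace M] [ChartedSpace E M] [IsManifold 𝓘(ℝ, E) ∞ M]

section Dir

variable (u v : VField E M) (f g : SmoothFn E M)

theorem dir_add_left : dir (u + v) f = dir u f + dir v f := by
  ext x
  exact map_add (mfderiv 𝓘(ℝ, E) 𝓘(ℝ) f x) (u x) (v x)

theorem dir_neg_left : dir (-u) f = -dir u f := by
  ext x
  exact map_neg (mfderiv 𝓘(ℝ, E) 𝓘(ℝ) f x) (u x)

theorem dir_zero_left : dir (0 : VField E M) f = 0 := by
  ext x
  exact map_zero (mfderiv 𝓘(ℝ, E) 𝓘(ℝ) f x)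

theorem dir_smul_left : dir (g • u) f = g * dir u f := by
  ext x
  exact map_smul (mfderiv 𝓘(ℝ, E) 𝓘(ℝ) f x) (g x) (u x)

theorem dir_const_smul_left (c : ℝ) : dir (c • u) f = c • dir u f := by
  ext x
  exact map_smul (mfderiv 𝓘(ℝ, E) 𝓘(ℝ) f x) c (u x)

theorem dir_add : dir u (f + g) = dir u f + dir u g := map_add (dirDerivation u) f g

theorem dir_sub : dir u (f - g) = dir u f - dir u g := map_sub (dirDerivation u) f g

theorem dir_neg : dir u (-f) = -dir u f := map_neg (dirDerivation u) f

theorem dir_zero : dir u (0 : SmoothFn E M) = 0 := map_zero (dirDerivation u)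

theorem dir_const_smul (c : ℝ) : dir u (c • f) = c • dir u f :=
  (dirDerivation u).map_smul c f

theorem dir_mul : dir u (f * g) = f * dir u g + g * dir u f := (dirDerivation u).leibniz f g

theorem dir_algebraMap (c : ℝ) : dir u (algebraMap ℝ (SmoothFn E M) c) = 0 :=
  (dirDerivation u).map_algebraMap c

end Dir

theorem Form.IsExtDeriv.ofFn_iff {f : SmoothFn E M} {β : Form E M 1} :
    (Form.ofFn f).IsExtDeriv β ↔ ∀ u, β.eval u = dir (u 0) f := by
  refine forall_congr' fun u => ?_
  have h : Finset.Ioi (0 : Fin 1) = ∅ := by decide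
  rw [Fin.sum_univ_one, Fin.sum_univ_one, h, Finset.sum_empty, add_zero, Fin.val_zero, pow_zero,
    one_smul]
  rfl

theorem mem_hamPairs {Ω : Form E M 2} {v : VField E M} {f : SmoothFn E M} :
    (v, f) ∈ hamPairs Ω ↔ ∀ u, Ω.eval ![v, u] = -dir u f := by
  have h (u : Fin 1 → VField E M) :
      (-Form.interior v Ω : Form E M 1).eval u = -Ω.eval ![v, u 0] := by
    ext x
    change -(Ω x (Matrix.vecCons (v x) fun i => u i x)) = -(Ω x fun i => (![v, u 0] : _) i x)
    congr 2
    ext i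
    fin_cases i <;> rfl
  refine Form.IsExtDeriv.ofFn_iff.trans ⟨fun H u => ?_, fun H u => ?_⟩
  · rw [← neg_eq_iff_eq_neg]
    simpa only [h] using H fun _ => u
  · rw [h]
    change -Ω.eval ![v, u 0] = dir (u 0) f
    rw [H, neg_neg]

/-- Gives linearity in the second slot through `map_update_add` and `map_update_smul`; the entry `0`
is a placeholder. -/
theorem vecCons_eq_update {V : Type*} [Zero V] (v w : V) :
    ![v, w] = Function.update ![v, 0] 1 w := by
  ext i
  fin_cases i <;> rfl

theorem VField.sum_apply {ι : Type*} (s : Finset ι) (u : ι → VField E M) (x : M) :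
    (∑ i ∈ s, u i) x = ∑ i ∈ s, u i x :=
  (congrFun (map_sum (ContMDiffSection.coeAddHom 𝓘(ℝ, E) E ∞
    (TangentSpace 𝓘(ℝ, E) : M → Type _)) u s) x).trans (Finset.sum_apply x s _)

/-- The bilinear form `(v, w) ↦ Ω(v, w)` on the tangent space at `x`. -/
def Form.bilin (Ω : Form E M 2) (x : M) :
    TangentSpace 𝓘(ℝ, E) x →ₗ[ℝ] TangentSpace 𝓘(ℝ, E) x →ₗ[ℝ] ℝ :=
  LinearMap.mk₂ ℝ (fun v w => Ω x ![v, w])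
    (fun v v' w => (Ω x).map_vecCons_add ![w] v v')
    (fun c v w => (Ω x).map_vecCons_smul ![w] c v)
    (fun v w w' => by
      rw [vecCons_eq_update v (w + w'), vecCons_eq_update v w, vecCons_eq_update v w']
      exact (Ω x).map_update_add ![v, 0] 1 w w')
    (fun c v w => by
      rw [vecCons_eq_update v (c • w), vecCons_eq_update v w]
      exact (Ω x).map_update_smul ![v, 0] 1 c w)

theorem Form.bilin_apply (Ω : Form E M 2) (x : M) (v w : TangentSpace 𝓘(ℝ, E) x) :
    Ω.bilin x v w = Ω x ![v, w] := rfl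

theorem Form.eval_pair_apply (Ω : Form E M 2) (u v : VField E M) (x : M) :
    Ω.eval ![u, v] x = Ω.bilin x (u x) (v x) := by
  refine congrArg (Ω x) ?_
  ext i
  fin_cases i <;> rfl

theorem mem_hamPairs_iff_bilin {Ω : Form E M 2} {v : VField E M} {f : SmoothFn E M} :
    (v, f) ∈ hamPairs Ω ↔ ∀ u x, Ω.bilin x (v x) (u x) = -dir u f x := by
  rw [mem_hamPairs]
  refine forall_congr' fun u => ?_
  rw [ContMDiffMap.ext_iff]
  simp only [Form.eval_pair_apply]
  rfl

theorem Form.eval_pair_swap (Ω : Form E M 2) (u v : VField E M) :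
    Ω.eval ![v, u] = -Ω.eval ![u, v] := by
  ext x
  change _ = -Ω.eval ![u, v] x
  simp only [Form.eval_pair_apply, Form.bilin_apply]
  have h := (Ω x).map_swap ![u x, v x] (i := 0) (j := 1) (by decide)
  rw [← h]
  congr 1
  ext i
  fin_cases i <;> rfl

variable [T2Space M]

/-- Every tangent vector is a value of a global vector field. -/
theorem exists_vField_apply_eq (x : M) (w : TangentSpace 𝓘(ℝ, E) x) :
    ∃ u : VField E M, u x = w := by
  obtain ⟨e, he⟩ := exists_vField_frame (E := E) x
  obtain ⟨B, hB⟩ := he.self_of_nhds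
  refine ⟨∑ i, B.repr w i • e i, ?_⟩
  rw [VField.sum_apply]
  exact (Finset.sum_congr rfl fun i _ => congrArg (B.repr w i • ·) (hB i)).trans (B.sum_repr w)

variable {Ω : Form E M 2}

/-- The condition defining `hamPairs` only tests against global fields, but their values fill every
tangent space, so nondegeneracy applies. -/
theorem Form.IsSymplectic.hamPairs_unique (hΩ : Ω.IsSymplectic) {v w : VField E M}
    {f : SmoothFn E M} (hv : (v, f) ∈ hamPairs Ω) (hw : (w, f) ∈ hamPairs Ω) : v = w := by
  ext x
  refine sub_eq_zero.1 (hΩ.nondegenerate x _ fun z => ?_)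
  obtain ⟨u, rfl⟩ := exists_vField_apply_eq x z
  rw [← Form.bilin_apply, map_sub, LinearMap.sub_apply, mem_hamPairs_iff_bilin.1 hv,
    mem_hamPairs_iff_bilin.1 hw, sub_self]

theorem Form.IsSymplectic.exists_bilin_eq (hΩ : Ω.IsSymplectic) (x : M)
    (l : Module.Dual ℝ (TangentSpace 𝓘(ℝ, E) x)) : ∃ v, Ω.bilin x v = l := by
  have : FiniteDimensional ℝ (TangentSpace 𝓘(ℝ, E) x) := inferInstanceAs (FiniteDimensional ℝ E)
  have hinj : Function.Injective (Ω.bilin x) := by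
    refine (injective_iff_map_eq_zero _).2 fun v hv => hΩ.nondegenerate x v fun w => ?_
    rw [← Form.bilin_apply, hv, LinearMap.zero_apply]
  exact (LinearMap.injective_iff_surjective_of_finrank_eq_finrank
    Subspace.dual_finrank_eq.symm).1 hinj l

/-- Nondegeneracy gives `v` pointwise; only smoothness needs work. With the Gram matrix `A` of `Ω`
in a local frame `e` and `g j = -dir (e j) f`, the field `w` with coefficients `g · adj A` is smooth
and satisfies `Ω(w, e j) = det A * g j`. Hence `v = (det A)⁻¹ w` near `x₀`. -/
theorem Form.IsSymplectic.exists_hamPairs (hΩ : Ω.IsSymplectic) (f : SmoothFn E M) :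
    ∃ v : VField E M, (v, f) ∈ hamPairs Ω := by
  choose v hv using fun x => hΩ.exists_bilin_eq x (-(mfderiv 𝓘(ℝ, E) 𝓘(ℝ) f x).toLinearMap)
  refine ⟨⟨v, fun x₀ => ?_⟩, mem_hamPairs_iff_bilin.2 fun u x => congrArg (· (u x)) (hv x)⟩
  obtain ⟨e, he⟩ := exists_vField_frame (E := E) x₀
  set A : Matrix _ _ (SmoothFn E M) := Matrix.of fun i j => Ω.eval ![e i, e j] with hA
  set g : _ → SmoothFn E M := fun j => -dir (e j) f with hg
  set c := Matrix.vecMul g A.adjugate with hc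
  set w : VField E M := ∑ i, c i • e i with hw
  have hwx (x : M) : w x = ∑ i, c i x • e i x :=
    VField.sum_apply _ _ _
  have hAx (x : M) (i j) : A i j x = Ω.bilin x (e i x) (e j x) := Form.eval_pair_apply _ _ _ _
  have hwe (x : M) (j) : Ω.bilin x (w x) (e j x) = A.det x * g j x := by
    have h : Matrix.vecMul c A j = A.det * g j := by
      rw [hc, Matrix.vecMul_vecMul, Matrix.adjugate_mul, Matrix.vecMul_smul, Matrix.vecMul_one]
      rfl
    have h' := congrArg (ContMDiffMap.evalRingHom x) h
    rw [Matrix.vecMul, dotProduct, map_sum, map_mul] at h'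
    rw [hwx, map_sum, LinearMap.sum_apply]
    refine Eq.trans (Finset.sum_congr rfl fun i _ => ?_) h'
    rw [map_smul, LinearMap.smul_apply, ← hAx, map_mul]
    rfl
  -- If `det A` vanished at `x₀`, a nonzero row vector `a` with `a A = 0` would give a nonzero
  -- vector `∑ a i • B i` in the kernel of `Ω`.
  have hd : A.det x₀ ≠ 0 := fun h0 => by
    obtain ⟨B, hB⟩ := he.self_of_nhds
    set ev : SmoothFn E M →+* ℝ := ContMDiffMap.evalRingHom x₀
    have hdet : (ev.mapMatrix A).det = 0 := (ev.map_det A).symm.trans h0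
    obtain ⟨a, ha0, ha⟩ := Matrix.exists_vecMul_eq_zero_iff.2 hdet
    refine ha0 (funext fun i => Fintype.linearIndependent_iff.1 B.linearIndependent a ?_ i)
    refine hΩ.nondegenerate x₀ _ fun z => ?_
    rw [← Form.bilin_apply]
    have : Ω.bilin x₀ (∑ i, a i • B i) = 0 := by
      refine B.ext fun j => ?_
      rw [map_sum, LinearMap.sum_apply]
      refine Eq.trans (Finset.sum_congr rfl fun i _ => ?_) (congrFun ha j)
      rw [map_smul, LinearMap.smul_apply, ← hB, ← hB, ← hAx]
      rfl
    rw [this, LinearMap.zero_apply]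
  have hd' : ∀ᶠ x in nhds x₀, A.det x ≠ 0 :=
    A.det.contMDiff.continuous.continuousAt.eventually_ne hd
  have hsm : ContMDiffAt 𝓘(ℝ, E) (𝓘(ℝ, E).prod 𝓘(ℝ, E)) ∞
      (fun x => (⟨x, (A.det x)⁻¹ • w x⟩ : TangentBundle 𝓘(ℝ, E) M)) x₀ :=
    ContMDiffAt.smul_section ((A.det.contMDiff x₀).inv₀ hd) (w.contMDiff x₀)
  refine hsm.congr_of_eventuallyEq ?_
  filter_upwards [he, hd'] with x ⟨B, hB⟩ hx
  congr 1
  refine sub_eq_zero.1 (hΩ.nondegenerate x _ fun z => ?_)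
  rw [← Form.bilin_apply]
  have : Ω.bilin x (v x - (A.det x)⁻¹ • w x) = 0 := by
    refine B.ext fun j => ?_
    rw [← hB, map_sub, map_smul, LinearMap.sub_apply, LinearMap.smul_apply, hwe, hv, smul_eq_mul,
      inv_mul_cancel_left₀ hx]
    exact sub_self _
  rw [this, LinearMap.zero_apply]

end Hamiltonian

/-! ### Operations on Hamiltonian pairs and the Poisson algebra of a symplectic manifold. -/

section HamPairs

variable {E : Type*} [NormedAddCommGroup E] [NormedSpace ℝ E] [FiniteDimensional ℝ E]
  {M : Type*} [TopologicalSpace M] [ChartedSpace E M] [IsManifold 𝓘(ℝ, E) ∞ M]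
  {Ω : Form E M 2} {v w : VField E M} {f h : SmoothFn E M}

theorem eval_pair_add_left (u : VField E M) :
    Ω.eval ![v + w, u] = Ω.eval ![v, u] + Ω.eval ![w, u] := by
  ext x
  change _ = Ω.eval ![v, u] x + Ω.eval ![w, u] x
  simp only [Form.eval_pair_apply]
  exact LinearMap.map_add₂ (Ω.bilin x) (v x) (w x) (u x)

theorem eval_pair_smul_left (u : VField E M) : Ω.eval ![f • v, u] = f * Ω.eval ![v, u] := by
  ext x
  change _ = f x * Ω.eval ![v, u] x
  simp only [Form.eval_pair_apply]
  exact LinearMap.map_smul₂ (Ω.bilin x) (f x) (v x) (u x)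

theorem eval_pair_const_smul_left (c : ℝ) (u : VField E M) :
    Ω.eval ![c • v, u] = c • Ω.eval ![v, u] := by
  ext x
  change _ = c * Ω.eval ![v, u] x
  simp only [Form.eval_pair_apply]
  exact LinearMap.map_smul₂ (Ω.bilin x) c (v x) (u x)

theorem hamPairs_add (hv : (v, f) ∈ hamPairs Ω) (hw : (w, h) ∈ hamPairs Ω) :
    (v + w, f + h) ∈ hamPairs Ω := by
  rw [mem_hamPairs] at *
  intro u
  rw [eval_pair_add_left, hv, hw, dir_add, neg_add]

theorem hamPairs_const_smul (c : ℝ) (hv : (v, f) ∈ hamPairs Ω) :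
    (c • v, c • f) ∈ hamPairs Ω := by
  rw [mem_hamPairs] at *
  intro u
  rw [eval_pair_const_smul_left, hv, dir_const_smul, smul_neg]

theorem hamPairs_algebraMap (c : ℝ) :
    ((0 : VField E M), algebraMap ℝ (SmoothFn E M) c) ∈ hamPairs Ω := by
  rw [mem_hamPairs]
  intro u
  have := eval_pair_const_smul_left (Ω := Ω) (v := 0) 0 u
  rw [zero_smul, zero_smul] at this
  rw [this, dir_algebraMap, neg_zero]

theorem hamPairs_mul (hv : (v, f) ∈ hamPairs Ω) (hw : (w, h) ∈ hamPairs Ω) :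
    (f • w + h • v, f * h) ∈ hamPairs Ω := by
  rw [mem_hamPairs] at *
  intro u
  rw [eval_pair_add_left, eval_pair_smul_left, eval_pair_smul_left, hv, hw, dir_mul]
  ring

/-- Identifies `ω(v_f, v_h)` with `v_f h`. In the second form the bracket is visibly a derivation in
`h`. -/
theorem eval_pair_eq_dir (v : VField E M) (hw : (w, h) ∈ hamPairs Ω) :
    Ω.eval ![v, w] = dir v h := by
  rw [Form.eval_pair_swap, mem_hamPairs.1 hw, neg_neg]

/-- This is the invariant formula for `dΩ(v, w, u) = 0`, solved for the term containing `[v, w]`. -/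
theorem Form.IsSymplectic.eval_bracket (hΩ : Ω.IsSymplectic) (v w u : VField E M) :
    Ω.eval ![lieBracket v w, u] =
      dir v (Ω.eval ![w, u]) - dir w (Ω.eval ![v, u]) + dir u (Ω.eval ![v, w])
        - Ω.eval ![w, lieBracket v u] + Ω.eval ![v, lieBracket w u] := by
  have H := hΩ.closed ![v, w, u]
  have h0 : Finset.Ioi (0 : Fin 3) = {1, 2} := by decide
  have h1 : Finset.Ioi (1 : Fin 3) = {2} := by decide
  have h2 : Finset.Ioi (2 : Fin 3) = ∅ := by decide
  rw [Fin.sum_univ_three, Fin.sum_univ_three, h0, h1, h2, Finset.sum_empty, Finset.sum_singleton,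
    Finset.sum_pair (by decide)] at H
  have e0 : (0 : Fin 3).removeNth ![v, w, u] = ![w, u] := by ext i; fin_cases i <;> rfl
  have e1 : (1 : Fin 3).removeNth ![v, w, u] = ![v, u] := by ext i; fin_cases i <;> rfl
  have e2 : (2 : Fin 3).removeNth ![v, w, u] = ![v, w] := by ext i; fin_cases i <;> rfl
  have e3 (z) : (0 : Fin 3).removeNth (Function.update ![v, w, u] 1 z) = ![z, u] := by
    ext i; fin_cases i <;> rfl
  have e4 (z) : (0 : Fin 3).removeNth (Function.update ![v, w, u] 2 z) = ![w, z] := by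
    ext i; fin_cases i <;> rfl
  have e5 (z) : (1 : Fin 3).removeNth (Function.update ![v, w, u] 2 z) = ![v, z] := by
    ext i; fin_cases i <;> rfl
  have H0 : (0 : Form E M 3).eval ![v, w, u] = 0 := rfl
  rw [H0, e0, e1, e2, e3, e4, e5] at H
  change (0 : SmoothFn E M) = (-1 : ℝ) ^ 0 • dir v _ + (-1 : ℝ) ^ 1 • dir w _ +
    (-1 : ℝ) ^ 2 • dir u _ + ((-1 : ℝ) ^ (0 + 1) • Ω.eval ![lieBracket v w, u] +
      (-1 : ℝ) ^ (0 + 1) • Ω.eval ![w, lieBracket v u] +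
      (-1 : ℝ) ^ (1 + 1) • Ω.eval ![v, lieBracket w u] + 0) at H
  simp only [pow_zero, pow_one, zero_add, one_add_one_eq_two, neg_sq, one_pow, one_smul,
    neg_smul] at H
  linear_combination H

/-- In `eval_bracket`, once the commutators are expanded, everything cancels except `u (w f) = -u (v
h)`. -/
theorem Form.IsSymplectic.hamPairs_lieBracket (hΩ : Ω.IsSymplectic)
    (hv : (v, f) ∈ hamPairs Ω) (hw : (w, h) ∈ hamPairs Ω) :
    (lieBracket v w, dir v h) ∈ hamPairs Ω := by
  have hvw : -dir w f = dir v h := (mem_hamPairs.1 hv w).symm.trans (eval_pair_eq_dir v hw)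
  rw [mem_hamPairs]
  intro u
  rw [hΩ.eval_bracket, eval_pair_eq_dir v hw, ← hvw]
  simp only [mem_hamPairs.1 hv, mem_hamPairs.1 hw, dir_lieBracket, dir_neg]
  have h' := congrArg (dir u) hvw
  rw [dir_neg] at h'
  linear_combination h'

variable [T2Space M]

/-- The Hamiltonian vector field of a function. -/
def Form.IsSymplectic.hamField (hΩ : Ω.IsSymplectic) (f : SmoothFn E M) : VField E M :=
  (hΩ.exists_hamPairs f).choose

theorem Form.IsSymplectic.hamField_mem (hΩ : Ω.IsSymplectic) (f : SmoothFn E M) :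
    (hΩ.hamField f, f) ∈ hamPairs Ω :=
  (hΩ.exists_hamPairs f).choose_spec

theorem Form.IsSymplectic.hamField_eq (hΩ : Ω.IsSymplectic) (hv : (v, f) ∈ hamPairs Ω) :
    hΩ.hamField f = v :=
  hΩ.hamPairs_unique (hΩ.hamField_mem f) hv

/-- The Poisson algebra `C^∞(M, ω)` of a symplectic manifold. -/
def Form.IsSymplectic.poisson (hΩ : Ω.IsSymplectic) : PoissonStructure (SmoothFn E M) where
  bracket := LinearMap.mk₂ ℝ (fun f h => dir (hΩ.hamField f) h)
    (fun f g h => by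
      rw [hΩ.hamField_eq (hamPairs_add (hΩ.hamField_mem f) (hΩ.hamField_mem g)), dir_add_left])
    (fun c f h => by
      rw [hΩ.hamField_eq (hamPairs_const_smul c (hΩ.hamField_mem f)), dir_const_smul_left])
    (fun f g h => dir_add _ _ _)
    (fun c f h => dir_const_smul _ _ _)
  self f := by
    have h := (mem_hamPairs.1 (hΩ.hamField_mem f) (hΩ.hamField f)).symm.trans
      (eval_pair_eq_dir _ (hΩ.hamField_mem f))
    ext x
    exact self_eq_neg.1 (congrArg (· x) h.symm)
  jacobi a b c := by
    simp only [LinearMap.mk₂_apply]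
    have anti (f h : SmoothFn E M) : dir (hΩ.hamField f) h = -dir (hΩ.hamField h) f :=
      (eval_pair_eq_dir _ (hΩ.hamField_mem h)).symm.trans (mem_hamPairs.1 (hΩ.hamField_mem f) _)
    -- The field of `{a, b}` is `[v_a, v_b]`, so `{c, {a, b}} = -[v_a, v_b] c`; this cancels the
    -- other two terms by the commutator formula.
    rw [anti c (dir _ _), hΩ.hamField_eq
      (hΩ.hamPairs_lieBracket (hΩ.hamField_mem a) (hΩ.hamField_mem b)), dir_lieBracket, anti c a,
      dir_neg]
    ring
  leibniz a b c := by
    simp only [LinearMap.mk₂_apply, dir_mul]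
    ring

theorem Form.IsSymplectic.poisson_bracket (hΩ : Ω.IsSymplectic) (f h : SmoothFn E M) :
    hΩ.poisson.bracket f h = dir (hΩ.hamField f) h := rfl

end HamPairs

/-! ### Rules for the Lie bracket of vector fields. -/

section Brackets

variable {E : Type*} [NormedAddCommGroup E] [NormedSpace ℝ E] [FiniteDimensional ℝ E]
  {M : Type*} [TopologicalSpace M] [T2Space M] [ChartedSpace E M] [IsManifold 𝓘(ℝ, E) ∞ M]
  (u v w : VField E M) (a : SmoothFn E M)

theorem lieBracket_add_right : lieBracket u (v + w) = lieBracket u v + lieBracket u w := by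
  refine dir_injective (funext fun f => ?_)
  simp only [dir_lieBracket, dir_add_left, dir_add]
  ring

theorem lieBracket_add_left : lieBracket (u + v) w = lieBracket u w + lieBracket v w := by
  refine dir_injective (funext fun f => ?_)
  simp only [dir_lieBracket, dir_add_left, dir_add]
  ring

theorem lieBracket_zero_right : lieBracket u 0 = 0 := by
  refine dir_injective (funext fun f => ?_)
  simp only [dir_lieBracket, dir_zero_left, dir_zero, sub_zero]

theorem lieBracket_zero_left : lieBracket 0 u = 0 := by
  refine dir_injective (funext fun f => ?_)
  simp only [dir_lieBracket, dir_zero_left, dir_zero, sub_zero]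

theorem lieBracket_smul_right : lieBracket u (a • v) = dir u a • v + a • lieBracket u v := by
  refine dir_injective (funext fun f => ?_)
  simp only [dir_lieBracket, dir_add_left, dir_smul_left, dir_mul]
  ring

theorem lieBracket_smul_left : lieBracket (a • u) v = a • lieBracket u v - dir v a • u := by
  refine dir_injective (funext fun f => ?_)
  rw [sub_eq_add_neg]
  simp only [dir_lieBracket, dir_add_left, dir_neg_left, dir_smul_left, dir_mul]
  ring

theorem lieBracket_const_smul_left (c : ℝ) : lieBracket (c • u) v = c • lieBracket u v := by
  refine dir_injective (funext fun f => ?_)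
  simp only [dir_lieBracket, dir_const_smul_left, dir_const_smul, smul_sub]

theorem lieBracket_lieBracket : lieBracket (lieBracket u v) w =
    lieBracket u (lieBracket v w) - lieBracket v (lieBracket u w) := by
  refine dir_injective (funext fun f => ?_)
  rw [sub_eq_add_neg]
  simp only [dir_lieBracket, dir_add_left, dir_neg_left, dir_sub]
  ring

end Brackets

/-! ### Reducible and vanishing observables. -/

section Reduction

variable {E : Type*} [NormedAddCommGroup E] [NormedSpace ℝ E] [FiniteDimensional ℝ E]
  {M : Type*} [TopologicalSpace M] [ChartedSpace E M] [IsManifold 𝓘(ℝ, E) ∞ M]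
  {N : Set M}

variable (N) in
/-- `I_N` as an ideal. -/
def vanishingIdeal : Ideal (SmoothFn E M) where
  carrier := constraintIdeal N
  add_mem' {f g} hf hg x hx := by
    change f x + g x = 0
    rw [hf x hx, hg x hx, add_zero]
  zero_mem' _ _ := rfl
  smul_mem' f g hg x hx := by
    change f x * g x = 0
    rw [hg x hx, mul_zero]

theorem mem_vanishingIdeal {f : SmoothFn E M} :
    f ∈ vanishingIdeal N ↔ f ∈ constraintIdeal N := Iff.rfl

theorem const_smul_mem_vanishingIdeal (c : ℝ) {f : SmoothFn E M} (hf : f ∈ vanishingIdeal N) :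
    c • f ∈ vanishingIdeal N := fun x hx => by
  change c * f x = 0
  rw [hf x hx, mul_zero]

variable (N) in
/-- `𝔛_N(M)` as a submodule. -/
def tangentModule : Submodule (SmoothFn E M) (VField E M) where
  carrier := tangentFields N
  add_mem' {u v} hu hv f hf := by
    rw [dir_add_left]
    exact (vanishingIdeal N).add_mem (hu f hf) (hv f hf)
  zero_mem' f _ := by
    rw [dir_zero_left]
    exact (vanishingIdeal N).zero_mem
  smul_mem' g u hu f hf := by
    rw [dir_smul_left]
    exact (vanishingIdeal N).mul_mem_left g (hu f hf)

variable (N) in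
/-- `I_𝔛(N)` as a submodule. -/
def vanishingModule : Submodule (SmoothFn E M) (VField E M) where
  carrier := vanishingFields N
  add_mem' {u v} hu hv f := by
    rw [dir_add_left]
    exact (vanishingIdeal N).add_mem (hu f) (hv f)
  zero_mem' f := by
    rw [dir_zero_left]
    exact (vanishingIdeal N).zero_mem
  smul_mem' g u hu f := by
    rw [dir_smul_left]
    exact (vanishingIdeal N).mul_mem_left g (hu f)

/-- Absorbs the terms of the Leibniz rules whose coefficient vanishes on `N`. -/
theorem smul_mem_vanishingModule {f : SmoothFn E M} (hf : f ∈ constraintIdeal N)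
    (u : VField E M) : f • u ∈ vanishingModule N := fun g => by
  rw [dir_smul_left]
  exact (vanishingIdeal N).mul_mem_right _ hf

theorem lieBracket_mem_tangentFields {u v : VField E M} (hu : u ∈ tangentFields N)
    (hv : v ∈ tangentFields N) : lieBracket u v ∈ tangentFields N := fun f hf => by
  rw [dir_lieBracket]
  exact (vanishingIdeal N).sub_mem (hu _ (hv f hf)) (hv _ (hu f hf))

theorem lieBracket_mem_vanishingFields {u v : VField E M} (hu : u ∈ tangentFields N)
    (hv : v ∈ vanishingFields N) : lieBracket u v ∈ vanishingFields N := fun f => by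
  rw [dir_lieBracket]
  exact (vanishingIdeal N).sub_mem (hu _ (hv f)) (hv _)

theorem const_smul_eq_algebraMap_smul (c : ℝ) (u : VField E M) :
    c • u = algebraMap ℝ (SmoothFn E M) c • u := by
  ext x
  rfl

theorem const_smul_mem (S : Submodule (SmoothFn E M) (VField E M)) (c : ℝ) {u : VField E M}
    (hu : u ∈ S) : c • u ∈ S := by
  rw [const_smul_eq_algebraMap_smul]
  exact S.smul_mem _ hu

/-- A form in the vanishing de Rham ideal is in `I_N` on vector fields tangent to `N`. -/
theorem VanishesAlong.eval_mem {k : ℕ} {α : Form E M k} (h : VanishesAlong N α) :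
    ∀ u : Fin k → VField E M, (∀ i, u i ∈ tangentFields N) → α.eval u ∈ vanishingIdeal N := by
  have wedge_apply {k l : ℕ} (α : Form E M k) (β : Form E M l) (u : Fin (k + l) → VField E M)
      (x : M) : (α.wedge β).eval u x = (k.factorial * l.factorial : ℝ)⁻¹ *
        ∑ σ : Equiv.Perm (Fin (k + l)), ((σ.sign : ℤ) : ℝ) *
          (α.eval (fun i => u (σ (Fin.castAdd l i))) x *
            β.eval (fun i => u (σ (Fin.natAdd k i))) x) := by
    change (α.wedge β) x (fun i => u i x) = _
    simp only [Form.wedge, MultilinearMap.alternatization_apply, AlternatingMap.smul_apply,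
      smul_eq_mul]
    refine congrArg _ (Finset.sum_congr rfl fun σ _ => ?_)
    simp [Units.smul_def]
    rfl
  induction h with
  | generator α h => exact h
  | add α β _ _ hα hβ => exact fun u hu => (vanishingIdeal N).add_mem (hα u hu) (hβ u hu)
  | wedge_left β α _ hα =>
    intro u hu x hx
    rw [wedge_apply, Finset.sum_eq_zero, mul_zero]
    intro σ _
    rw [hα _ (fun i => hu _) x hx, mul_zero, mul_zero]
  | wedge_right α β _ hα =>
    intro u hu x hx
    rw [wedge_apply, Finset.sum_eq_zero, mul_zero]
    intro σ _
    rw [hα _ (fun i => hu _) x hx, zero_mul, mul_zero]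
  | extDeriv α β hd _ hα =>
    intro u hu
    rw [hd u]
    refine (vanishingIdeal N).add_mem (sum_mem fun i _ => ?_)
      (sum_mem fun i _ => sum_mem fun j _ => ?_)
    · exact const_smul_mem_vanishingIdeal _ (hu i _ (hα _ fun j => hu _))
    -- The inserted entry is a bracket of two tangent fields, hence tangent, so the induction
    -- hypothesis applies to `α`.
    · refine const_smul_mem_vanishingIdeal _ (hα _ fun m => ?_)
      change Function.update u j _ (i.succAbove m) ∈ _
      rw [Function.update_apply]
      split_ifs
      · exact lieBracket_mem_tangentFields (hu i) (hu j)
      · exact hu _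

/-- In degree `0` there are no arguments to insert, so the value lemma gives `f ∈ I_N` itself: the
wedge products and differentials add no functions to the ideal. -/
theorem VanishesAlong.ofFn_iff {f : SmoothFn E M} :
    VanishesAlong N (Form.ofFn f) ↔ f ∈ constraintIdeal N :=
  ⟨fun h => h.eval_mem Fin.elim0 fun i => i.elim0, fun h => .generator _ fun _ _ => h⟩

variable {𝔤 : Type*} [LieRing 𝔤] [LieAlgebra ℝ 𝔤] {ρ : LieAction E M 𝔤}

/-- The Lie derivative of a function is `dir (ρ ξ) f`. The contraction of a `0`-form is the zero
form, placed in degree `0 - 1 = 0`, and imposes no condition. -/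
theorem Form.IsReducible.ofFn_iff {f : SmoothFn E M} :
    (Form.ofFn f).IsReducible ρ N ↔ ∀ ξ, dir (ρ ξ) f ∈ constraintIdeal N := by
  refine forall_congr' fun ξ => ⟨fun ⟨⟨β, hβ, hv⟩, _⟩ => ?_, fun h => ⟨⟨Form.ofFn (dir (ρ ξ) f),
    fun u => ?_, VanishesAlong.ofFn_iff.2 h⟩, .generator _ fun u _ => (vanishingIdeal N).zero_mem⟩⟩
  · have h := hβ Fin.elim0
    rw [Finset.univ_eq_empty, Finset.sum_empty, sub_zero] at h
    have h' := hv.eval_mem Fin.elim0 fun i => i.elim0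
    rw [h] at h'
    exact h'
  · rw [Finset.univ_eq_empty, Finset.sum_empty, sub_zero]
    rfl

variable (ρ N) in
/-- `𝔛_𝔤(M) + I_𝔛(N)` as a submodule. -/
def LieAction.alongModule : Submodule (SmoothFn E M) (VField E M) :=
  ρ.fundamentalModule ⊔ vanishingModule N

theorem LieAction.mem_alongModule {u : VField E M} :
    u ∈ ρ.alongModule N ↔ u ∈ ρ.fundamentalAlong N := by
  simp only [LieAction.alongModule, Submodule.mem_sup, eq_comm (a := u), LieAction.fundamentalAlong,
    Set.mem_ofPred_eq]
  rfl

theorem LieAction.apply_mem_alongModule (ξ : 𝔤) : ρ ξ ∈ ρ.alongModule N :=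
  Submodule.mem_sup_left (Submodule.subset_span ⟨ξ, rfl⟩)

theorem vanishingModule_le_alongModule : vanishingModule N ≤ ρ.alongModule N := le_sup_right

/-- The hypothesis `hsmul` also receives `u ∈ ρ.alongModule N`: the Leibniz rule for `[v, f • u]`
yields a multiple of `u` itself. -/
theorem LieAction.alongModule_induction {p : VField E M → Prop} (hρ : ∀ ξ, p (ρ ξ))
    (hv : ∀ u ∈ vanishingFields N, p u) (h0 : p 0) (hadd : ∀ u v, p u → p v → p (u + v))
    (hsmul : ∀ (f : SmoothFn E M) u, u ∈ ρ.alongModule N → p u → p (f • u)) {u : VField E M}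
    (hu : u ∈ ρ.alongModule N) : p u := by
  let S : Submodule (SmoothFn E M) (VField E M) :=
    { carrier := {u | u ∈ ρ.alongModule N ∧ p u}
      add_mem' := fun ha hb => ⟨add_mem ha.1 hb.1, hadd _ _ ha.2 hb.2⟩
      zero_mem' := ⟨zero_mem _, h0⟩
      smul_mem' := fun f u hu => ⟨Submodule.smul_mem _ f hu.1, hsmul f u hu.1 hu.2⟩ }
  have h1 : ρ.fundamentalModule ≤ S := Submodule.span_le.2 (by
    rintro _ ⟨ξ, rfl⟩
    exact ⟨LieAction.apply_mem_alongModule ξ, hρ ξ⟩)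
  have h2 : vanishingModule N ≤ S := fun u hu => ⟨vanishingModule_le_alongModule hu, hv u hu⟩
  exact (sup_le h1 h2 hu).2

/-- A function with invariant restriction to `N` is annihilated along `N` by `𝔛_𝔤(M) + I_𝔛(N)`. -/
theorem dir_mem_of_mem_alongModule {u : VField E M} {h : SmoothFn E M}
    (hu : u ∈ ρ.alongModule N) (hh : ∀ ξ, dir (ρ ξ) h ∈ constraintIdeal N) :
    dir u h ∈ vanishingIdeal N := by
  refine LieAction.alongModule_induction
    (p := fun u => dir u h ∈ vanishingIdeal N) hh (fun u hu => hu h) ?_ (fun u v hu hv => ?_)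
    (fun f u _ hu => ?_) hu
  · rw [dir_zero_left]
    exact zero_mem _
  · rw [dir_add_left]
    exact add_mem hu hv
  · rw [dir_smul_left]
    exact Ideal.mul_mem_left _ _ hu

variable [T2Space M]

/-- Reducibility only controls brackets with the generators `ρ ξ`. The rule `[v, f u] = (v f) u + f
[v, u]` extends this to the module, and tangency of `v` handles `I_𝔛(N)`. -/
theorem lieBracket_mem_alongModule {v u : VField E M} (hv : v ∈ reducibleFields ρ N)
    (hu : u ∈ ρ.alongModule N) : lieBracket v u ∈ ρ.alongModule N := by
  refine LieAction.alongModule_induction (p := fun u => lieBracket v u ∈ ρ.alongModule N)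
    (fun ξ => LieAction.mem_alongModule.2 (hv.2 ξ)) (fun u hu => vanishingModule_le_alongModule
      (lieBracket_mem_vanishingFields hv.1 hu)) ?_ (fun u w hu hw => ?_)
    (fun f u hu hvu => ?_) hu
  · rw [lieBracket_zero_right]
    exact zero_mem _
  · rw [lieBracket_add_right]
    exact add_mem hu hw
  · rw [lieBracket_smul_right]
    exact add_mem (Submodule.smul_mem _ _ hu) (Submodule.smul_mem _ _ hvu)

theorem mem_reducibleFields {v : VField E M} : v ∈ reducibleFields ρ N ↔
    v ∈ tangentModule N ∧ ∀ ξ, lieBracket v (ρ ξ) ∈ ρ.alongModule N := by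
  simp only [LieAction.mem_alongModule]
  rfl

variable {Ω : Form E M 2} {v w : VField E M} {f h : SmoothFn E M}

theorem mem_reducibleObservables : (v, f) ∈ reducibleObservables Ω ρ N ↔
    (v, f) ∈ hamPairs Ω ∧ v ∈ reducibleFields ρ N ∧ ∀ ξ, dir (ρ ξ) f ∈ vanishingIdeal N :=
  and_congr_right' (and_congr_right' Form.IsReducible.ofFn_iff)

theorem reducibleObservables_add (hv : (v, f) ∈ reducibleObservables Ω ρ N)
    (hw : (w, h) ∈ reducibleObservables Ω ρ N) : (v + w, f + h) ∈ reducibleObservables Ω ρ N := by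
  rw [mem_reducibleObservables, mem_reducibleFields] at *
  obtain ⟨hv, ⟨tv, bv⟩, rf⟩ := hv
  obtain ⟨hw, ⟨tw, bw⟩, rh⟩ := hw
  refine ⟨hamPairs_add hv hw, ⟨add_mem tv tw, fun ξ => ?_⟩, fun ξ => ?_⟩
  · rw [lieBracket_add_left]
    exact add_mem (bv ξ) (bw ξ)
  · rw [dir_add]
    exact add_mem (rf ξ) (rh ξ)

theorem reducibleObservables_const_smul (c : ℝ) (hv : (v, f) ∈ reducibleObservables Ω ρ N) :
    (c • v, c • f) ∈ reducibleObservables Ω ρ N := by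
  rw [mem_reducibleObservables, mem_reducibleFields] at *
  obtain ⟨hv, ⟨tv, bv⟩, rf⟩ := hv
  refine ⟨hamPairs_const_smul c hv, ⟨const_smul_mem _ c tv, fun ξ => ?_⟩, fun ξ => ?_⟩
  · rw [lieBracket_const_smul_left]
    exact const_smul_mem _ c (bv ξ)
  · rw [dir_const_smul]
    exact const_smul_mem_vanishingIdeal c (rf ξ)

theorem reducibleObservables_algebraMap (c : ℝ) :
    ((0 : VField E M), algebraMap ℝ (SmoothFn E M) c) ∈ reducibleObservables Ω ρ N := by
  rw [mem_reducibleObservables, mem_reducibleFields]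
  refine ⟨hamPairs_algebraMap c, ⟨zero_mem _, fun ξ => ?_⟩, fun ξ => ?_⟩
  · rw [lieBracket_zero_left]
    exact zero_mem _
  · rw [dir_algebraMap]
    exact zero_mem _

/-- In `[g u, ξ_M] = g [u, ξ_M] - (ξ_M g) u` the last term lies in `I_𝔛(N)`, because `ξ_M g`
vanishes on `N` for reducible `g`. Reducibility of the function and of the field are thus both
needed. -/
theorem reducibleObservables_mul (hv : (v, f) ∈ reducibleObservables Ω ρ N)
    (hw : (w, h) ∈ reducibleObservables Ω ρ N) :
    (f • w + h • v, f * h) ∈ reducibleObservables Ω ρ N := by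
  rw [mem_reducibleObservables, mem_reducibleFields] at *
  obtain ⟨hv, ⟨tv, bv⟩, rf⟩ := hv
  obtain ⟨hw, ⟨tw, bw⟩, rh⟩ := hw
  have smul_mem {u : VField E M} {g : SmoothFn E M} {ξ : 𝔤}
      (hu : lieBracket u (ρ ξ) ∈ ρ.alongModule N) (hg : dir (ρ ξ) g ∈ vanishingIdeal N) :
      lieBracket (g • u) (ρ ξ) ∈ ρ.alongModule N := by
    rw [lieBracket_smul_left]
    exact sub_mem (Submodule.smul_mem _ _ hu)
      (vanishingModule_le_alongModule (smul_mem_vanishingModule hg u))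
  refine ⟨hamPairs_mul hv hw, ⟨add_mem (Submodule.smul_mem _ _ tw) (Submodule.smul_mem _ _ tv),
    fun ξ => ?_⟩, fun ξ => ?_⟩
  · rw [lieBracket_add_left]
    exact add_mem (smul_mem (bw ξ) (rf ξ)) (smul_mem (bv ξ) (rh ξ))
  · rw [dir_mul]
    exact add_mem (Ideal.mul_mem_left _ _ (rh ξ)) (Ideal.mul_mem_left _ _ (rf ξ))

/-- The field part is the Jacobi identity with `lieBracket_mem_alongModule`. For the function, `ξ_M
(v h) = v (ξ_M h) - [v, ξ_M] h`: `v` preserves `I_N`, and `[v, ξ_M]` lies in the module, which sends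
`h` into `I_N`. -/
theorem Form.IsSymplectic.reducibleObservables_lieBracket (hΩ : Ω.IsSymplectic)
    (hv : (v, f) ∈ reducibleObservables Ω ρ N) (hw : (w, h) ∈ reducibleObservables Ω ρ N) :
    (lieBracket v w, dir v h) ∈ reducibleObservables Ω ρ N := by
  rw [mem_reducibleObservables] at *
  obtain ⟨hv, bv, rf⟩ := hv
  obtain ⟨hw, bw, rh⟩ := hw
  refine ⟨hΩ.hamPairs_lieBracket hv hw, mem_reducibleFields.2
    ⟨lieBracket_mem_tangentFields bv.1 bw.1, fun ξ => ?_⟩, fun ξ => ?_⟩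
  · rw [lieBracket_lieBracket]
    exact sub_mem (lieBracket_mem_alongModule bv ((mem_reducibleFields.1 bw).2 ξ))
      (lieBracket_mem_alongModule bw ((mem_reducibleFields.1 bv).2 ξ))
  · have h' : dir (ρ ξ) (dir v h) = dir v (dir (ρ ξ) h) - dir (lieBracket v (ρ ξ)) h := by
      rw [dir_lieBracket]
      ring
    rw [h']
    exact sub_mem (bv.1 _ (rh ξ)) (dir_mem_of_mem_alongModule ((mem_reducibleFields.1 bv).2 ξ) rh)

/-- The generating set is already a real subspace, so taking the span adds nothing. -/
theorem mem_vanishingObservables {p : VField E M × SmoothFn E M} :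
    p ∈ vanishingObservables Ω ρ N ↔ p ∈ reducibleObservables Ω ρ N ∧
      p.1 ∈ ρ.alongModule N ∧ p.2 ∈ vanishingIdeal N := by
  have hset : {p ∈ reducibleObservables Ω ρ N |
      p.1 ∈ ρ.fundamentalAlong N ∧ VanishesAlong N (Form.ofFn p.2)} =
      {p ∈ reducibleObservables Ω ρ N | p.1 ∈ ρ.alongModule N ∧ p.2 ∈ vanishingIdeal N} := by
    ext p
    simp only [Set.mem_ofPred_eq, LieAction.mem_alongModule, VanishesAlong.ofFn_iff,
      mem_vanishingIdeal]
  rw [vanishingObservables, hset]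
  refine ⟨fun hp => ?_, fun hp => Submodule.subset_span hp⟩
  induction hp using Submodule.span_induction with
  | mem x h => exact h
  | zero =>
    have h0 := reducibleObservables_algebraMap (Ω := Ω) (ρ := ρ) (N := N) 0
    rw [map_zero] at h0
    exact ⟨h0, zero_mem _, zero_mem _⟩
  | add p q _ _ hp hq =>
    exact ⟨reducibleObservables_add hp.1 hq.1, add_mem hp.2.1 hq.2.1, add_mem hp.2.2 hq.2.2⟩
  | smul c p _ hp =>
    exact ⟨reducibleObservables_const_smul c hp.1, const_smul_mem _ c hp.2.1,
      const_smul_mem_vanishingIdeal c hp.2.2⟩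

theorem vanishingObservables_mul (hv : (v, f) ∈ reducibleObservables Ω ρ N)
    (hw : (w, h) ∈ vanishingObservables Ω ρ N) :
    (f • w + h • v, f * h) ∈ vanishingObservables Ω ρ N := by
  rw [mem_vanishingObservables] at *
  exact ⟨reducibleObservables_mul hv hw.1, add_mem (Submodule.smul_mem _ _ hw.2.1)
    (vanishingModule_le_alongModule (smul_mem_vanishingModule hw.2.2 v)),
    Ideal.mul_mem_left _ _ hw.2.2⟩

theorem Form.IsSymplectic.vanishingObservables_lieBracket (hΩ : Ω.IsSymplectic)
    (hv : (v, f) ∈ reducibleObservables Ω ρ N) (hw : (w, h) ∈ vanishingObservables Ω ρ N) :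
    (lieBracket v w, dir v h) ∈ vanishingObservables Ω ρ N := by
  rw [mem_vanishingObservables] at *
  have hv' := (mem_reducibleObservables.1 hv).2.1
  exact ⟨hΩ.reducibleObservables_lieBracket hv hw.1, lieBracket_mem_alongModule hv' hw.2.1,
    hv'.1 _ hw.2.2⟩

/-- By uniqueness of the Hamiltonian field, the image under `(v, f) ↦ f` loses no information. -/
theorem Form.IsSymplectic.mem_LInftyReducible (hΩ : Ω.IsSymplectic) :
    f ∈ LInftyReducible Ω ρ N ↔ (hΩ.hamField f, f) ∈ reducibleObservables Ω ρ N := by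
  refine ⟨?_, fun h => ⟨_, h, rfl⟩⟩
  rintro ⟨⟨v, f⟩, hv, rfl⟩
  rwa [hΩ.hamField_eq (mem_reducibleObservables.1 hv).1]

theorem Form.IsSymplectic.mem_LInftyVanishing (hΩ : Ω.IsSymplectic) :
    f ∈ LInftyVanishing Ω ρ N ↔ (hΩ.hamField f, f) ∈ vanishingObservables Ω ρ N := by
  refine ⟨?_, fun h => ⟨_, h, rfl⟩⟩
  rintro ⟨⟨v, f⟩, hv, rfl⟩
  have hv' := (mem_vanishingObservables.1 hv).1
  rwa [hΩ.hamField_eq (mem_reducibleObservables.1 hv').1]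

variable (Ω ρ N) in
/-- `L_∞(M, ω)_[N]` as a subalgebra of `C^∞(M)`. -/
def reducibleSubalgebra : Subalgebra ℝ (SmoothFn E M) where
  carrier := LInftyReducible Ω ρ N
  add_mem' := by
    rintro _ _ ⟨p, hp, rfl⟩ ⟨q, hq, rfl⟩
    exact ⟨_, reducibleObservables_add hp hq, rfl⟩
  mul_mem' := by
    rintro _ _ ⟨p, hp, rfl⟩ ⟨q, hq, rfl⟩
    exact ⟨_, reducibleObservables_mul hp hq, rfl⟩
  algebraMap_mem' c := ⟨_, reducibleObservables_algebraMap c, rfl⟩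

theorem Form.IsSymplectic.bracket_mem_reducibleSubalgebra (hΩ : Ω.IsSymplectic)
    (hf : f ∈ reducibleSubalgebra N ρ Ω) (hh : h ∈ reducibleSubalgebra N ρ Ω) :
    hΩ.poisson.bracket f h ∈ reducibleSubalgebra N ρ Ω :=
  ⟨_, hΩ.reducibleObservables_lieBracket (hΩ.mem_LInftyReducible.1 hf)
    (hΩ.mem_LInftyReducible.1 hh), rfl⟩

variable (ρ N) in
/-- `I_{L_∞}(N)` as an ideal of `L_∞(M, ω)_[N]`. -/
def Form.IsSymplectic.vanishingSubalgebraIdeal (hΩ : Ω.IsSymplectic) :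
    Ideal (reducibleSubalgebra N ρ Ω) where
  carrier := {f | (f : SmoothFn E M) ∈ LInftyVanishing Ω ρ N}
  add_mem' := by
    rintro _ _ ⟨p, hp, hp'⟩ ⟨q, hq, hq'⟩
    exact ⟨_, add_mem hp hq, congrArg₂ (· + ·) hp' hq'⟩
  zero_mem' := ⟨_, zero_mem _, rfl⟩
  smul_mem' f g hg := ⟨_, vanishingObservables_mul (hΩ.mem_LInftyReducible.1 f.2)
    (hΩ.mem_LInftyVanishing.1 hg), rfl⟩

theorem Form.IsSymplectic.bracket_mem_LInftyVanishing (hΩ : Ω.IsSymplectic)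
    (hf : f ∈ LInftyReducible Ω ρ N) (hh : h ∈ LInftyVanishing Ω ρ N) :
    hΩ.poisson.bracket f h ∈ LInftyVanishing Ω ρ N :=
  ⟨_, hΩ.vanishingObservables_lieBracket (hΩ.mem_LInftyReducible.1 hf)
    (hΩ.mem_LInftyVanishing.1 hh), rfl⟩

theorem LInftyVanishing_subset : LInftyVanishing Ω ρ N ⊆ LInftyReducible Ω ρ N := by
  rintro _ ⟨p, hp, rfl⟩
  exact ⟨p, (mem_vanishingObservables.1 hp).1, rfl⟩

end Reduction

/-! ### Poisson subalgebras and quotients by Poisson ideals. -/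

namespace PoissonStructure

variable {A : Type*} [CommRing A] [Algebra ℝ A] (P : PoissonStructure A)

theorem bracket_swap (a b : A) : P.bracket a b = -P.bracket b a := by
  have h := P.self (a + b)
  rw [map_add, map_add, LinearMap.add_apply, LinearMap.add_apply, P.self, P.self, zero_add,
    add_zero] at h
  exact eq_neg_of_add_eq_zero_right h

@[ext]
theorem ext {P Q : PoissonStructure A} (h : ∀ a b, P.bracket a b = Q.bracket a b) : P = Q := by
  cases P
  cases Q
  congr
  exact LinearMap.ext₂ h

/-- The restriction of a Poisson structure to a Poisson subalgebra. -/
def restrict (S : Subalgebra ℝ A) (hS : ∀ f ∈ S, ∀ h ∈ S, P.bracket f h ∈ S) :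
    PoissonStructure S where
  bracket := LinearMap.mk₂ ℝ (fun f h => ⟨P.bracket f h, hS f f.2 h h.2⟩)
    (fun f g h => Subtype.ext (LinearMap.map_add₂ P.bracket f.1 g.1 h.1))
    (fun c f h => Subtype.ext (LinearMap.map_smul₂ P.bracket c f.1 h.1))
    (fun f g h => Subtype.ext (map_add (P.bracket f.1) g.1 h.1))
    (fun c f h => Subtype.ext (map_smul (P.bracket f.1) c h.1))
  self f := Subtype.ext (P.self f)
  jacobi f g h := Subtype.ext (P.jacobi f g h)
  leibniz f g h := Subtype.ext (P.leibniz f g h)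

/-- The difference is `{f, h - h'} + {f - f', h'}`; antisymmetry brings the second term under `hJ`.
-/
theorem mk_bracket_congr (J : Ideal A) (hJ : ∀ f, ∀ h ∈ J, P.bracket f h ∈ J)
    {f f' h h' : A} (hf : Ideal.Quotient.mk J f = Ideal.Quotient.mk J f')
    (hh : Ideal.Quotient.mk J h = Ideal.Quotient.mk J h') :
    Ideal.Quotient.mk J (P.bracket f h) = Ideal.Quotient.mk J (P.bracket f' h') := by
  rw [Ideal.Quotient.eq] at *
  have h1 := hJ f _ hh
  have h2 := hJ h' _ hf
  rw [P.bracket_swap, neg_mem_iff, map_sub, LinearMap.sub_apply] at h2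
  rw [map_sub] at h1
  convert add_mem h1 h2 using 1
  abel

/-- The Poisson structure induced on the quotient by a Poisson ideal. -/
def quotient (J : Ideal A) (hJ : ∀ f, ∀ h ∈ J, P.bracket f h ∈ J) : PoissonStructure (A ⧸ J) :=
  -- The bracket is defined on chosen representatives; `key` removes the choice, after which each
  -- axiom descends from `A`.
  have key (f h : A) : Ideal.Quotient.mk J (P.bracket (Ideal.Quotient.mk J f).out
      (Ideal.Quotient.mk J h).out) = Ideal.Quotient.mk J (P.bracket f h) :=
    P.mk_bracket_congr J hJ (Ideal.Quotient.mk_out _) (Ideal.Quotient.mk_out _)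
  { bracket := LinearMap.mk₂ ℝ (fun a b => Ideal.Quotient.mk J (P.bracket a.out b.out))
      (fun a b c => by
        obtain ⟨a, rfl⟩ := Ideal.Quotient.mk_surjective a
        obtain ⟨b, rfl⟩ := Ideal.Quotient.mk_surjective b
        obtain ⟨c, rfl⟩ := Ideal.Quotient.mk_surjective c
        rw [← map_add, key, key, key, LinearMap.map_add₂, map_add])
      (fun r a b => by
        obtain ⟨a, rfl⟩ := Ideal.Quotient.mk_surjective a
        obtain ⟨b, rfl⟩ := Ideal.Quotient.mk_surjective b
        have hr (c : A) : r • Ideal.Quotient.mk J c = Ideal.Quotient.mk J (r • c) := rfl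
        rw [hr, key, key, LinearMap.map_smul₂, hr])
      (fun a b c => by
        obtain ⟨a, rfl⟩ := Ideal.Quotient.mk_surjective a
        obtain ⟨b, rfl⟩ := Ideal.Quotient.mk_surjective b
        obtain ⟨c, rfl⟩ := Ideal.Quotient.mk_surjective c
        rw [← map_add, key, key, key, map_add, map_add])
      (fun r a b => by
        obtain ⟨a, rfl⟩ := Ideal.Quotient.mk_surjective a
        obtain ⟨b, rfl⟩ := Ideal.Quotient.mk_surjective b
        have hr (c : A) : r • Ideal.Quotient.mk J c = Ideal.Quotient.mk J (r • c) := rfl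
        rw [hr, key, key, map_smul, hr])
    self := fun a => by
      obtain ⟨a, rfl⟩ := Ideal.Quotient.mk_surjective a
      rw [LinearMap.mk₂_apply, key, P.self, map_zero]
    jacobi := fun a b c => by
      obtain ⟨a, rfl⟩ := Ideal.Quotient.mk_surjective a
      obtain ⟨b, rfl⟩ := Ideal.Quotient.mk_surjective b
      obtain ⟨c, rfl⟩ := Ideal.Quotient.mk_surjective c
      simp only [LinearMap.mk₂_apply, key]
      rw [← map_add, ← map_add, P.jacobi, map_zero]
    leibniz := fun a b c => by
      obtain ⟨a, rfl⟩ := Ideal.Quotient.mk_surjective a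
      obtain ⟨b, rfl⟩ := Ideal.Quotient.mk_surjective b
      obtain ⟨c, rfl⟩ := Ideal.Quotient.mk_surjective c
      rw [← map_mul]
      simp only [LinearMap.mk₂_apply, key]
      rw [P.leibniz, map_add, map_mul, map_mul] }

theorem quotient_bracket_mk (J : Ideal A) (hJ : ∀ f, ∀ h ∈ J, P.bracket f h ∈ J) (f h : A) :
    (P.quotient J hJ).bracket (Ideal.Quotient.mk J f) (Ideal.Quotient.mk J h) =
      Ideal.Quotient.mk J (P.bracket f h) :=
  P.mk_bracket_congr J hJ (Ideal.Quotient.mk_out _) (Ideal.Quotient.mk_out _)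

/-- The quotient by a Poisson ideal carries exactly one Poisson structure for which the projection
preserves brackets. -/
theorem existsUnique_quotient (J : Ideal A) (hJ : ∀ f, ∀ h ∈ J, P.bracket f h ∈ J) :
    ∃! Q : PoissonStructure (A ⧸ J), ∀ f h, Q.bracket (Ideal.Quotient.mk J f)
      (Ideal.Quotient.mk J h) = Ideal.Quotient.mk J (P.bracket f h) := by
  refine ⟨P.quotient J hJ, P.quotient_bracket_mk J hJ, fun Q hQ => ext fun a b => ?_⟩
  obtain ⟨a, rfl⟩ := Ideal.Quotient.mk_surjective a
  obtain ⟨b, rfl⟩ := Ideal.Quotient.mk_surjective b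
  rw [hQ, quotient_bracket_mk]

end PoissonStructure

end SymplecticReduction

end

/-! ### The reduction theorem. -/

theorem theorem4p1
    {E : Type*} [NormedAddCommGroup E] [NormedSpace ℝ E] [FiniteDimensional ℝ E]
    {M : Type*} [TopologicalSpace M] [T2Space M] [SecondCountableTopology M]
    [ChartedSpace E M] [IsManifold 𝓘(ℝ, E) ∞ M]
    (Ω : SymplecticReduction.Form E M 2) (hΩ : Ω.IsSymplectic)
    {𝔤 : Type*} [LieRing 𝔤] [LieAlgebra ℝ 𝔤]
    (ρ : SymplecticReduction.LieAction E M 𝔤) (N : Set M) (hρ : ρ.IsTangent N)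
    (hred : Ω.IsReducible ρ N) :
    -- every smooth function has exactly one Hamiltonian vector field
    (∀ f : SymplecticReduction.SmoothFn E M,
      ∃! v : SymplecticReduction.VField E M, (v, f) ∈ SymplecticReduction.hamPairs Ω) ∧
    -- the Poisson algebra `C^∞(M, ω)`, with `{f, h} = ω(v_f, v_h)`
    ∃ P : SymplecticReduction.PoissonStructure (SymplecticReduction.SmoothFn E M),
      (∀ v f w h, (v, f) ∈ SymplecticReduction.hamPairs Ω →
        (w, h) ∈ SymplecticReduction.hamPairs Ω → P.bracket f h = Ω.eval ![v, w]) ∧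
      -- `L_∞(M, ω)_[N]` is a Poisson subalgebra
      ∃ A : Subalgebra ℝ (SymplecticReduction.SmoothFn E M),
        (A : Set (SymplecticReduction.SmoothFn E M)) =
          SymplecticReduction.LInftyReducible Ω ρ N ∧
        ∃ hA : ∀ f ∈ A, ∀ h ∈ A, P.bracket f h ∈ A,
        -- `I_{L_∞}(N)` is an associative ideal and a Lie ideal in it
        ∃ J : Ideal A,
          Subtype.val '' (J : Set A) = SymplecticReduction.LInftyVanishing Ω ρ N ∧
          (∀ f : A, ∀ h ∈ J, (⟨P.bracket f h, hA f f.2 h h.2⟩ : A) ∈ J) ∧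
          -- the quotient carries exactly one Poisson bracket induced by that of `C^∞(M, ω)`
          ∃! Q : SymplecticReduction.PoissonStructure (A ⧸ J),
            ∀ f h : A, Q.bracket (Ideal.Quotient.mk J f) (Ideal.Quotient.mk J h) =
              Ideal.Quotient.mk J ⟨P.bracket f h, hA f f.2 h h.2⟩ := by
  refine ⟨fun f => ⟨hΩ.hamField f, hΩ.hamField_mem f, fun v hv => (hΩ.hamField_eq hv).symm⟩,
    hΩ.poisson, fun v f w h hv hw => ?_, SymplecticReduction.reducibleSubalgebra N ρ Ω, rfl,
    fun f hf h hh => hΩ.bracket_mem_reducibleSubalgebra hf hh,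
    hΩ.vanishingSubalgebraIdeal N ρ, ?_, fun f h hh => hΩ.bracket_mem_LInftyVanishing f.2 hh, ?_⟩
  · rw [hΩ.poisson_bracket, hΩ.hamField_eq hv, SymplecticReduction.eval_pair_eq_dir v hw]
  · ext f
    refine ⟨?_, fun hf => ⟨⟨f, SymplecticReduction.LInftyVanishing_subset hf⟩, hf, rfl⟩⟩
    rintro ⟨g, hg, rfl⟩
    exact hg
  -- The ideal lives in the subalgebra, so the bracket is restricted before passing to the quotient.
  · exact (hΩ.poisson.restrict (SymplecticReduction.reducibleSubalgebra N ρ Ω)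
      fun f hf h hh => hΩ.bracket_mem_reducibleSubalgebra hf hh).existsUnique_quotient _
        fun f h hh => hΩ.bracket_mem_LInftyVanishing f.2 hh
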